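/- There are constants $0<\eta<1$ and $b>0$ such that the following holds. Consider multi-agent contract instances with binary actions: $n$ agents, the single action of agent $i$ being $i$, costs $c_i\ge 0$, and a monotone submodular success probability function $f:2^{[n]}\to[0,1]$ with $f(\emptyset)=0$. For a contract $\alpha\in[0,1]^n$ and an action set $S\subseteq[n]$, the principal's utility is $u_p(S,\alpha)=\bigl(1-\sum_i\alpha_i\bigr)f(S)$ and agent $i$'s utility is $\alpha_i f(S)-c_i\mathbf 1[i\in S]$. A pair $(\alpha,S)$ is an $\eta$-approximate optimal contract if $S$ is a pure Nash equilibrium of the agents' game under $\alpha$ and $u_p(S,\alpha)\ge\eta\cdot\sup u_p(S',\alpha')$, where the supremum is over all contracts $\alpha'$ and all pure Nash equilibria $S'$ under $\alpha'$. For every $q:\mathbb N\to\mathbb N$ with $q(n)=2^{o(n)}$ there is an $N$ such that for all $n\ge N$ and every (adaptive, randomized, computationally unbounded) algorithm that is given $c$ and makes at most $q(n)$ value queries (given $S$, the answer is $f(S)$) and demand queries (given $p\in\mathbb R^n$, the answer is some set maximizing $f(S)-\sum_{j\in S}p_j$), there is such an instance $(c,f)$ and a demand oracle for $f$ on which the algorithm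 returns an $\eta$-approximate optimal contract with probability at most $e^{-bn}$. Consequently there is no PTAS for the optimal contract problem with submodular $f$ and value and demand oracles, even for binary actions: for no $\delta>0$ do there exist, for every $\varepsilon>0$, randomized algorithms making at most polynomially many (in $n$) queries that return a $(1-\varepsilon)$-approximate optimal contract with probability at least $\delta$ on every such instance, for every demand oracle. -/

import Mathlib

open Filter MeasureTheory

/-! Multi-agent contract design with combinatorial actions (reward normalised to `r = 1`),
value and demand oracles, and adaptive (randomized) query algorithms. -/

namespace Contracts

universe u

section Model

/-- A set function is submodular if marginal contributions are non-increasing. -/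
def IsSubmodular {A : Type*} [DecidableEq A] (f : Finset A → ℝ) : Prop :=
  ∀ S S' : Finset A, S ⊆ S' → ∀ j : A, f (insert j S') - f S' ≤ f (insert j S) - f S

/-- Success probability functions: normalised, non-decreasing, with values in `[0, 1]`. -/
structure IsSuccessFunction {A : Type*} (f : Finset A → ℝ) : Prop where
  empty : f ∅ = 0
  mono : ∀ S S' : Finset A, S ⊆ S' → f S ≤ f S'
  mem_Icc : ∀ S : Finset A, f S ∈ Set.Icc (0 : ℝ) 1

/-- A (linear) contract pays agent `i` the fraction `α i ∈ [0, 1]` of the reward upon success. -/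
def IsContract {ι : Type*} (α : ι → ℝ) : Prop :=
  ∀ i, α i ∈ Set.Icc (0 : ℝ) 1

/-- The principal's utility `(1 - ∑ᵢ αᵢ) f(S)`. -/
def principalUtility {ι A : Type*} [Fintype ι] (f : Finset A → ℝ) (α : ι → ℝ) (S : Finset A) : ℝ :=
  (1 - ∑ i, α i) * f S

/-- The utility `αᵢ f(S) - c(S ∩ Aᵢ)` of agent `i`, where `Aᵢ = {j | owner j = i}`. -/
def agentUtility {ι A : Type*} [DecidableEq ι] (owner : A → ι) (f : Finset A → ℝ) (c : A → ℝ)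
    (α : ι → ℝ) (i : ι) (S : Finset A) : ℝ :=
  α i * f S - ∑ j ∈ S with owner j = i, c j

/-- `S` is a pure Nash equilibrium for `α`: no agent `i` gains by changing only his own part
of the action set, that is, by moving to some `S'` that agrees with `S` outside of `Aᵢ`. -/
def IsNash {ι A : Type*} [DecidableEq ι] (owner : A → ι) (f : Finset A → ℝ) (c : A → ℝ)
    (α : ι → ℝ) (S : Finset A) : Prop :=
  ∀ (i : ι) (S' : Finset A), (∀ j, owner j ≠ i → (j ∈ S' ↔ j ∈ S)) →
    agentUtility owner f c α i S' ≤ agentUtility owner f c α i S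

/-- The optimal principal's utility over all contracts and all their equilibria. -/
noncomputable def optimalUtility {ι A : Type*} [Fintype ι] [DecidableEq ι] (owner : A → ι)
    (f : Finset A → ℝ) (c : A → ℝ) : ℝ :=
  sSup {u : ℝ | ∃ (α : ι → ℝ) (S : Finset A),
    IsContract α ∧ IsNash owner f c α S ∧ u = principalUtility f α S}

/-- `(α, S)` is a `κ`-approximately optimal contract with recommended equilibrium `S`. -/
def IsApproxOptimal {ι A : Type*} [Fintype ι] [DecidableEq ι] (κ : ℝ) (owner : A → ι)
    (f : Finset A → ℝ) (c : A → ℝ) (α : ι → ℝ) (S : Finset A) : Prop :=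
  IsContract α ∧ IsNash owner f c α S ∧
    κ * optimalUtility owner f c ≤ principalUtility f α S

/-- `D` answers demand queries to `f`: at prices `p`, the set `D p` maximizes `f(S) - p(S)`.
Ties may be broken in any way. -/
def IsDemandOracle {A : Type*} (f : Finset A → ℝ) (D : (A → ℝ) → Finset A) : Prop :=
  ∀ (p : A → ℝ) (S : Finset A), f S - ∑ j ∈ S, p j ≤ f (D p) - ∑ j ∈ D p, p j

end Model

section Algorithms

/-- Deterministic adaptive query algorithms of unbounded computational power, as decision trees:
either return a contract with a recommended action set, or ask a value query or a demand query
and continue depending on the answer. -/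
inductive QueryAlgorithm (ι A : Type) : Type
  | output (α : ι → ℝ) (S : Finset A) : QueryAlgorithm ι A
  | value (S : Finset A) (next : ℝ → QueryAlgorithm ι A) : QueryAlgorithm ι A
  | demand (p : A → ℝ) (next : Finset A → QueryAlgorithm ι A) : QueryAlgorithm ι A

/-- The output when value queries are answered by `f` and demand queries by `D`. -/
def QueryAlgorithm.run {ι A : Type} (f : Finset A → ℝ) (D : (A → ℝ) → Finset A) :
    QueryAlgorithm ι A → (ι → ℝ) × Finset A
  | .output α S => (α, S)
  | .value S next => (next (f S)).run f D
  | .demand p next => (next (D p)).run f D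

/-- The number of (value and demand) queries asked in the same run. -/
def QueryAlgorithm.queryCount {ι A : Type} (f : Finset A → ℝ) (D : (A → ℝ) → Finset A) :
    QueryAlgorithm ι A → ℕ
  | .output _ _ => 0
  | .value S next => (next (f S)).queryCount f D + 1
  | .demand p next => (next (D p)).queryCount f D + 1

/-- Instances of the problem with `n` agents and binary actions (agent `i` has the single action
`i`, so `owner = id`): non-negative costs `c`, a submodular success probability function `f`, and
a demand oracle `D` for `f`. -/
structure IsBinaryInstance {n : ℕ} (c : Fin n → ℝ) (f : Finset (Fin n) → ℝ)
    (D : (Fin n → ℝ) → Finset (Fin n)) : Prop where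
  cost_nonneg : ∀ i, 0 ≤ c i
  success : IsSuccessFunction f
  submodular : IsSubmodular f
  demand : IsDemandOracle f D

/-- A randomized algorithm for binary-action instances with `n` agents. It receives the costs,
draws a seed `ω` from an arbitrary probability space, and then runs a deterministic query
algorithm. The output on every instance is required to be a random variable. -/
structure RandomizedAlgorithm (n : ℕ) where
  Ω : Type u
  mΩ : MeasurableSpace Ω
  μ : Measure Ω
  isProbabilityMeasure : IsProbabilityMeasure μ
  strategy : (Fin n → ℝ) → Ω → QueryAlgorithm (Fin n) (Fin n)
  measurable_contract : ∀ c f D, IsBinaryInstance c f D →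
    Measurable fun ω => ((strategy c ω).run f D).1
  measurable_actions : ∀ c f D, IsBinaryInstance c f D →
    ∀ S, MeasurableSet {ω | ((strategy c ω).run f D).2 = S}

/-- On every instance and for every seed, the algorithm asks at most `q` queries. -/
def RandomizedAlgorithm.QueriesAtMost {n : ℕ} (R : RandomizedAlgorithm.{u} n) (q : ℕ) : Prop :=
  ∀ c f D, IsBinaryInstance c f D → ∀ ω, (R.strategy c ω).queryCount f D ≤ q

/-- The probability that the algorithm returns a `κ`-approximately optimal contract. -/
noncomputable def RandomizedAlgorithm.successProb {n : ℕ} (R : RandomizedAlgorithm.{u} n) (κ : ℝ)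
    (c : Fin n → ℝ) (f : Finset (Fin n) → ℝ) (D : (Fin n → ℝ) → Finset (Fin n)) : ℝ :=
  (R.μ {ω | IsApproxOptimal κ id f c
    ((R.strategy c ω).run f D).1 ((R.strategy c ω).run f D).2}).toReal

/-- `q(n) = 2 ^ o(n)`. -/
def IsSubexponential (q : ℕ → ℕ) : Prop :=
  ∀ ε : ℝ, 0 < ε → ∀ᶠ n : ℕ in atTop, (q n : ℝ) ≤ Real.exp (ε * n)

/-- A polynomial-query approximation scheme for binary actions that succeeds with probability at
least `δ`: for every fixed `ε > 0` there are algorithms asking polynomially many queries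
and returning a `(1 - ε)`-approximately optimal contract with probability at least `δ` on every
instance. Running time is not restricted beyond the number of queries, so every PTAS (in which a
query takes at least one unit of time) is such a scheme, with `δ = 1`. -/
def HasPolyQueryPTAS (δ : ℝ) : Prop :=
  ∀ ε : ℝ, 0 < ε → ∃ (P : Polynomial ℕ) (R : (n : ℕ) → RandomizedAlgorithm.{u} n),
    ∀ n : ℕ, (R n).QueriesAtMost (P.eval n) ∧
      ∀ c f D, IsBinaryInstance c f D → δ ≤ (R n).successProb (1 - ε) c f D

end Algorithms

end Contracts

/-! A set `T` of `4 * m` agents is hidden, and one agent `z` is the only one with a cost. Without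
`z` and up to scale, the reward averages a uniform-matroid rank and half of a rank capped at `3 * m`
inside `T`; adding `z` replaces that half rank by the constant 1. On a typical set the two ranks
agree, and inducing `z` at full rank costs a share 1/4. On `T` the capped rank is smaller, so the
marginal value of `z` is larger and the share 1/5 suffices. The optimum is thus at least 4/5, while
an equilibrium on a set that does not witness `T` yields at most 3/4 < 19/20 · 4/5
(`mem_revealing_of_isApproxOptimal`).

Off the witnessing sets the reward equals its `T = ∅` version, and elsewhere it is no larger, so
demand answers outside the witnessing family can be kept (`IsDemandOracle.exists_of_le`). A run
against `T = ∅` is therefore faithful unless it discloses a witness. For a random transversal `T` of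
`4 * m` pairs, a fixed set is a witness with probability at most (625/1024)^m
(`card_filter_mem_revealing_le`). A union bound over the disclosed sets and the output, then
averaging over `T`, gives the theorem. -/

namespace Contracts

/-! ### Indistinguishability of oracles along a run. -/

section Simulation

variable {ι A : Type} [DecidableEq A]

/-- The sets whose values are disclosed in a run: the value queries and the demand answers. -/
def QueryAlgorithm.disclosed (f : Finset A → ℝ) (D : (A → ℝ) → Finset A) :
    QueryAlgorithm ι A → Finset (Finset A)
  | .output _ _ => ∅
  | .value S next => insert S ((next (f S)).disclosed f D)
  | .demand p next => insert (D p) ((next (D p)).disclosed f D)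

theorem QueryAlgorithm.card_disclosed_le (f : Finset A → ℝ) (D : (A → ℝ) → Finset A)
    (Q : QueryAlgorithm ι A) : (Q.disclosed f D).card ≤ Q.queryCount f D := by
  induction Q with
  | output α S => simp [disclosed]
  | value S next ih =>
    exact (Finset.card_insert_le _ _).trans (Nat.succ_le_succ (ih _))
  | demand p next ih =>
    exact (Finset.card_insert_le _ _).trans (Nat.succ_le_succ (ih _))

/-- Two oracle pairs that agree off a family `B` of sets are indistinguishable in a run that
discloses no member of `B`. -/
theorem QueryAlgorithm.run_eq_of_disclosed {f g : Finset A → ℝ} {D E : (A → ℝ) → Finset A}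
    {B : Set (Finset A)} (hf : ∀ S ∉ B, g S = f S) (hD : ∀ p, D p ∉ B → E p = D p)
    (Q : QueryAlgorithm ι A) (hQ : ∀ S ∈ Q.disclosed f D, S ∉ B) :
    Q.run g E = Q.run f D := by
  induction Q with
  | output α S => rfl
  | value S next ih =>
    simp only [disclosed, Finset.mem_insert, forall_eq_or_imp] at hQ
    simp only [run]
    rw [hf S hQ.1]
    exact ih _ hQ.2
  | demand p next ih =>
    simp only [disclosed, Finset.mem_insert, forall_eq_or_imp] at hQ
    simp only [run]
    rw [hD p hQ.1]
    exact ih _ hQ.2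

end Simulation

/-! ### Transfer of demand oracles. -/

section Demand

variable {A : Type*} [Finite A]

theorem exists_isDemandOracle (f : Finset A → ℝ) : ∃ D, IsDemandOracle f D := by
  have h : ∀ p : A → ℝ, ∃ S₀ : Finset A, ∀ S, f S - ∑ j ∈ S, p j ≤ f S₀ - ∑ j ∈ S₀, p j :=
    fun p => Finite.exists_max fun S : Finset A => f S - ∑ j ∈ S, p j
  choose D hD using h
  exact ⟨D, hD⟩

/-- Lowering `f` on a family `B` changes demand answers only where the answer lies in `B`. -/
theorem IsDemandOracle.exists_of_le {f g : Finset A → ℝ} {D : (A → ℝ) → Finset A}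
    (hD : IsDemandOracle f D) {B : Set (Finset A)} (hle : ∀ S, g S ≤ f S)
    (heq : ∀ S ∉ B, g S = f S) :
    ∃ E, IsDemandOracle g E ∧ ∀ p, D p ∉ B → E p = D p := by
  classical
  obtain ⟨E, hE⟩ := exists_isDemandOracle g
  refine ⟨fun p => if D p ∈ B then E p else D p, fun p S => ?_, fun p hp => if_neg hp⟩
  by_cases hp : D p ∈ B
  · simpa only [if_pos hp] using hE p S
  -- The old maximizer keeps its value while all competitors can only drop, so it remains a
  -- maximizer.
  · simp only [if_neg hp, heq _ hp]
    linarith [hD p S, hle S]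

end Demand

/-! ### The hidden-set reward: monotonicity, submodularity and witnesses. -/

section HardFunction

variable {A : Type*} [DecidableEq A]

/-- The rank of `S` without `z` in the matroid of sets with at most `4 * m` elements, at most
`3 * m` of them in `T`. -/
def hiddenRank (z : A) (m : ℕ) (T S : Finset A) : ℕ :=
  min (4 * m) (min (S ∩ T).card (3 * m) + ((S \ T).erase z).card)

/-- The success probability with hidden set `T` and expensive agent `z`. -/
noncomputable def hiddenReward (z : A) (m : ℕ) (T S : Finset A) : ℝ :=
  ((hiddenRank z m ∅ S : ℝ) / (4 * m) +
    if z ∈ S then 1 else (hiddenRank z m T S : ℝ) / (4 * m) / 2) / 2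

/-- The sets that witness the presence of `T`. -/
def revealing (z : A) (m : ℕ) (T : Finset A) : Set (Finset A) :=
  {S | hiddenRank z m T S ≠ hiddenRank z m ∅ S}

variable {z : A} {m : ℕ} {T S S' : Finset A}

theorem hiddenRank_mono (h : S ⊆ S') : hiddenRank z m T S ≤ hiddenRank z m T S' := by
  have h₁ := Finset.card_le_card (Finset.inter_subset_inter_right (u := T) h)
  have h₂ := Finset.card_le_card (Finset.erase_subset_erase z (Finset.sdiff_subset_sdiff h
    (le_refl T)))
  unfold hiddenRank
  omega

theorem hiddenRank_le : hiddenRank z m T S ≤ 4 * m := min_le_left _ _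

theorem hiddenRank_insert_self (hz : z ∉ T) :
    hiddenRank z m T (insert z S) = hiddenRank z m T S := by
  unfold hiddenRank
  rw [Finset.insert_inter_of_notMem hz, Finset.insert_sdiff_of_notMem _ hz,
    Finset.erase_insert_eq_erase]

theorem hiddenRank_erase_self (hz : z ∉ T) :
    hiddenRank z m T (S.erase z) = hiddenRank z m T S := by
  by_cases h : z ∈ S
  · rw [← hiddenRank_insert_self hz, Finset.insert_erase h]
  · rw [Finset.erase_eq_of_notMem h]

theorem card_inter_add_card_sdiff_erase (hz : z ∉ T) :
    (S ∩ T).card + ((S \ T).erase z).card = (S.erase z).card := by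
  have h : (S \ T).erase z = S.erase z \ T := by ext; simp; tauto
  have h' : S ∩ T = S.erase z ∩ T := by
    ext x
    simp only [Finset.mem_inter, Finset.mem_erase]
    refine ⟨fun hx => ⟨⟨fun hxz => hz (hxz ▸ hx.2), hx.1⟩, hx.2⟩, fun hx => ⟨hx.1.2, hx.2⟩⟩
  rw [h, h', Finset.card_inter_add_card_sdiff]

theorem hiddenRank_empty : hiddenRank z m ∅ S = min (4 * m) (S.erase z).card := by
  simp [hiddenRank]

theorem hiddenRank_le_hiddenRank_empty (hz : z ∉ T) :
    hiddenRank z m T S ≤ hiddenRank z m ∅ S := by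
  have := card_inter_add_card_sdiff_erase (S := S) hz
  rw [hiddenRank_empty]
  unfold hiddenRank
  omega

/-- The ranks differ only if the cap `3 * m` binds strictly on `S ∩ T` while fewer than `m` elements
other than `z` lie outside `T`; counting `z` leaves at most `m` there. -/
theorem card_of_mem_revealing (hz : z ∉ T) (h : S ∈ revealing z m T) :
    2 * m + (S \ T).card ≤ (S ∩ T).card := by
  have h₁ := card_inter_add_card_sdiff_erase (S := S) hz
  have h₂ := Finset.pred_card_le_card_erase (s := S \ T) (a := z)
  replace h : hiddenRank z m T S ≠ hiddenRank z m ∅ S := h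
  rw [hiddenRank_empty, hiddenRank] at h
  omega

theorem hiddenRank_insert_add_le (h : S ⊆ S') {j : A} (hj : j ∉ S') (hjz : j ≠ z) :
    hiddenRank z m T (insert j S') + hiddenRank z m T S ≤
      hiddenRank z m T (insert j S) + hiddenRank z m T S' := by
  have hjS : j ∉ S := fun hS => hj (h hS)
  have h₁ := Finset.card_le_card (Finset.inter_subset_inter_right (u := T) h)
  have h₂ := Finset.card_le_card (Finset.erase_subset_erase z (Finset.sdiff_subset_sdiff h
    (le_refl T)))
  unfold hiddenRank
  by_cases hjT : j ∈ T
  · simp only [Finset.insert_inter_of_mem hjT, Finset.insert_sdiff_of_mem _ hjT]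
    rw [Finset.card_insert_of_notMem (by simp [hj]), Finset.card_insert_of_notMem (by simp [hjS])]
    omega
  · simp only [Finset.insert_inter_of_notMem hjT, Finset.insert_sdiff_of_notMem _ hjT,
      Finset.erase_insert_of_ne hjz]
    rw [Finset.card_insert_of_notMem (by simp [hj]), Finset.card_insert_of_notMem (by simp [hjS])]
    omega

theorem hiddenRank_div_mem_Icc : (hiddenRank z m T S : ℝ) / (4 * m) ∈ Set.Icc (0 : ℝ) 1 := by
  refine ⟨by positivity, div_le_one_of_le₀ ?_ (by positivity)⟩
  exact_mod_cast hiddenRank_le (z := z) (T := T) (S := S)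

theorem isSuccessFunction_hiddenReward : IsSuccessFunction (hiddenReward z m T) where
  empty := by simp [hiddenReward, hiddenRank]
  mono S S' h := by
    have h₁ : (hiddenRank z m ∅ S : ℝ) / (4 * m) ≤ hiddenRank z m ∅ S' / (4 * m) := by
      gcongr; exact hiddenRank_mono h
    have h₂ : (hiddenRank z m T S : ℝ) / (4 * m) ≤ hiddenRank z m T S' / (4 * m) := by
      gcongr; exact hiddenRank_mono h
    have h₃ := (hiddenRank_div_mem_Icc (z := z) (m := m) (T := T) (S := S)).2
    unfold hiddenReward
    by_cases hS : z ∈ S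
    · rw [if_pos hS, if_pos (h hS)]; linarith
    · by_cases hS' : z ∈ S'
      · rw [if_neg hS, if_pos hS']; linarith
      · rw [if_neg hS, if_neg hS']; linarith
  mem_Icc S := by
    obtain ⟨h₁, h₂⟩ := hiddenRank_div_mem_Icc (z := z) (m := m) (T := ∅) (S := S)
    obtain ⟨h₃, h₄⟩ := hiddenRank_div_mem_Icc (z := z) (m := m) (T := T) (S := S)
    unfold hiddenReward
    split_ifs <;> constructor <;> linarith

/-- The marginal of `z` is 1/2 minus a quarter of the normalised rank, hence decreasing. For other
elements each rank is submodular, and the presence of `z` replaces a non-negative marginal of the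
second rank by 0. -/
theorem isSubmodular_hiddenReward (hz : z ∉ T) : IsSubmodular (hiddenReward z m T) := by
  intro S S' h j
  by_cases hj : j ∈ S'
  · rw [Finset.insert_eq_of_mem hj, sub_self]
    exact sub_nonneg.2 (isSuccessFunction_hiddenReward.mono _ _ (Finset.subset_insert _ _))
  by_cases hjz : j = z
  · subst hjz
    have h₂ : (hiddenRank j m T S : ℝ) / (4 * m) ≤ hiddenRank j m T S' / (4 * m) := by
      gcongr; exact hiddenRank_mono h
    have hjS : j ∉ S := fun hS => hj (h hS)
    simp only [hiddenReward, hiddenRank_insert_self (Finset.notMem_empty _), hj, hjS,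
      Finset.mem_insert_self, if_true, if_false]
    linarith
  · have key : ∀ U : Finset A, (hiddenRank z m U (insert j S') : ℝ) / (4 * m) +
        hiddenRank z m U S / (4 * m) ≤
        hiddenRank z m U (insert j S) / (4 * m) + hiddenRank z m U S' / (4 * m) := by
      intro U
      rw [← add_div, ← add_div]
      refine div_le_div_of_nonneg_right ?_ (by positivity)
      exact_mod_cast hiddenRank_insert_add_le h hj hjz
    have k₀ := key ∅
    have k₁ := key T
    have mono : (hiddenRank z m T S : ℝ) / (4 * m) ≤ hiddenRank z m T (insert j S) / (4 * m) := by
      gcongr; exact hiddenRank_mono (Finset.subset_insert _ _)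
    have hzi : ∀ U : Finset A, z ∈ insert j U ↔ z ∈ U := fun U => by
      simp [Finset.mem_insert, Ne.symm hjz]
    simp only [hiddenReward, hzi]
    by_cases hS : z ∈ S
    · simp only [hS, h hS, if_true]; linarith
    · by_cases hS' : z ∈ S'
      · simp only [hS, hS', if_true, if_false]; linarith
      · simp only [hS, hS', if_false]; linarith

theorem hiddenReward_le_hiddenReward_empty (hz : z ∉ T) (S : Finset A) :
    hiddenReward z m T S ≤ hiddenReward z m ∅ S := by
  unfold hiddenReward
  have : hiddenRank z m T S ≤ hiddenRank z m ∅ S := hiddenRank_le_hiddenRank_empty hz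
  split_ifs
  · exact le_rfl
  · gcongr

theorem hiddenReward_eq_of_notMem (h : S ∉ revealing z m T) :
    hiddenReward z m T S = hiddenReward z m ∅ S := by
  have : hiddenRank z m T S = hiddenRank z m ∅ S := not_not.1 h
  simp only [hiddenReward, this]

end HardFunction

/-! ### The utility gap between witnessing and other equilibria. -/

theorem principalUtility_le {ι : Type*} [Fintype ι] {f : Finset ι → ℝ} (hf : IsSuccessFunction f)
    {α : ι → ℝ} (hα : IsContract α) (i : ι) (S : Finset ι) :
    principalUtility f α S ≤ (1 - α i) * f S := by
  refine mul_le_mul_of_nonneg_right (sub_le_sub_left ?_ _) (hf.mem_Icc S).1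
  exact Finset.single_le_sum (fun j _ => (hα j).1) (Finset.mem_univ i)

section HardInstance

variable {ι : Type*} [DecidableEq ι] {z : ι} {m : ℕ} {T S : Finset ι}

/-- Only the agent `z` has a positive cost. -/
noncomputable def hiddenCost (z : ι) : ι → ℝ := Pi.single z (1 / 16)

theorem agentUtility_hiddenCost_self (f : Finset ι → ℝ) (α : ι → ℝ) (S : Finset ι) :
    agentUtility id f (hiddenCost z) α z S = α z * f S - if z ∈ S then 1 / 16 else 0 := by
  simp only [agentUtility, id, hiddenCost, Finset.sum_filter]
  congr 1
  rw [← Finset.sum_ite_eq' S z fun _ => (1 / 16 : ℝ)]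
  refine Finset.sum_congr rfl fun j _ => ?_
  by_cases hj : j = z
  · subst hj; simp
  · simp [hj]

theorem agentUtility_hiddenCost_of_ne (f : Finset ι → ℝ) (α : ι → ℝ) (S : Finset ι) {i : ι}
    (hi : i ≠ z) : agentUtility id f (hiddenCost z) α i S = α i * f S := by
  simp only [agentUtility, id, hiddenCost]
  rw [Finset.sum_eq_zero, sub_zero]
  intro j hj
  rw [(Finset.mem_filter.1 hj).2, Pi.single_eq_of_ne hi]

variable [Fintype ι]

theorem le_optimalUtility {f : Finset ι → ℝ} (hf : IsSuccessFunction f) {c α : ι → ℝ}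
    (hα : IsContract α) (hS : IsNash id f c α S) :
    principalUtility f α S ≤ optimalUtility id f c := by
  refine le_csSup ⟨1, ?_⟩ ⟨α, S, hα, hS, rfl⟩
  rintro _ ⟨β, U, hβ, -, rfl⟩
  have h₁ : 0 ≤ ∑ i, β i := Finset.sum_nonneg fun j _ => (hβ j).1
  have h₂ := hf.mem_Icc U
  unfold principalUtility
  nlinarith [mul_nonneg h₁ h₂.1, h₂.2]

theorem four_fifths_le_optimalUtility (hz : z ∉ T) (hm : 0 < m) (hT : T.card = 4 * m) :
    4 / 5 ≤ optimalUtility id (hiddenReward z m T) (hiddenCost z) := by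
  have hm' : (m : ℝ) ≠ 0 := by positivity
  have r₀ : hiddenRank z m ∅ T = 4 * m := by
    rw [hiddenRank_empty, Finset.erase_eq_of_notMem hz, hT, min_self]
  have r₁ : hiddenRank z m T T = 3 * m := by
    simp only [hiddenRank, Finset.inter_self, hT, Finset.sdiff_self, Finset.erase_empty,
      Finset.card_empty]
    omega
  have hT' : hiddenReward z m T T = 11 / 16 := by
    simp only [hiddenReward, r₀, r₁, hz, if_false]
    push_cast
    field_simp
    norm_num
  have hTz : hiddenReward z m T (insert z T) = 1 := by
    simp only [hiddenReward, hiddenRank_insert_self (Finset.notMem_empty _), r₀,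
      Finset.mem_insert_self, if_true]
    push_cast
    field_simp
    norm_num
  -- The share 1/5 makes `z` exactly indifferent: 1/5 · (1 - 11/16) = 1/16. The unpaid agents have
  -- no cost and are indifferent too.
  have hα : IsContract (Pi.single z (1 / 5) : ι → ℝ) := by
    intro i
    by_cases hi : i = z
    · subst hi; rw [Pi.single_eq_same]; norm_num
    · rw [Pi.single_eq_of_ne hi]; norm_num
  have hN : IsNash id (hiddenReward z m T) (hiddenCost z) (Pi.single z (1 / 5))
      (insert z T) := by
    intro i U hU
    by_cases hi : i = z
    · subst hi
      simp only [agentUtility_hiddenCost_self, Pi.single_eq_same, hTz, Finset.mem_insert_self,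
        if_true]
      by_cases hiU : i ∈ U
      · have : U = insert i T := by
          ext j
          by_cases hj : j = i
          · subst hj; simp [hiU]
          · exact hU j hj
        rw [this, hTz]; simp
      · have : U = T := by
          ext j
          by_cases hj : j = i
          · subst hj; simp [hiU, hz]
          · rw [hU j hj]; simp [hj]
        rw [this, hT', if_neg hz]; norm_num
    · simp only [agentUtility_hiddenCost_of_ne _ _ _ hi, Pi.single_eq_of_ne hi, zero_mul, le_refl]
  refine le_trans (le_of_eq ?_) (le_optimalUtility isSuccessFunction_hiddenReward hα hN)
  rw [principalUtility, hTz, Finset.sum_pi_single']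
  norm_num

theorem principalUtility_le_of_notMem_revealing (hz : z ∉ T) {α : ι → ℝ} (hα : IsContract α)
    (hN : IsNash id (hiddenReward z m T) (hiddenCost z) α S) (hS : S ∉ revealing z m T) :
    principalUtility (hiddenReward z m T) α S ≤ 3 / 4 := by
  refine (principalUtility_le isSuccessFunction_hiddenReward hα z S).trans ?_
  have hr : hiddenRank z m T S = hiddenRank z m ∅ S := not_not.1 hS
  obtain ⟨hx₀, hx₁⟩ := hiddenRank_div_mem_Icc (z := z) (m := m) (T := ∅) (S := S)
  obtain ⟨hα₀, hα₁⟩ := hα z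
  by_cases hzS : z ∈ S
  · have hdev := hN z (S.erase z) (fun j hj => by simp [show j ≠ z from hj])
    simp only [agentUtility_hiddenCost_self, hiddenReward, hzS, if_true, Finset.notMem_erase,
      if_false, hiddenRank_erase_self hz, hiddenRank_erase_self (Finset.notMem_empty _), hr]
      at hdev
    simp only [hiddenReward, hzS, if_true]
    generalize (hiddenRank z m ∅ S : ℝ) / (4 * m) = x at *
    generalize α z = a at *
    -- The marginal value of `z` is (2 - x)/4, so keeping `z` requires a ≥ 1/(8 - 4x). The next
    -- bound then reduces to (1 - x)(5 - 4x) ≥ 0, with equality at full rank x = 1.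
    have h₁ : (1 - a) * (8 - 4 * x) ≤ 7 - 4 * x := by nlinarith
    have h₂ : (1 - a) * ((x + 1) / 2) * (8 - 4 * x) ≤ 3 / 4 * (8 - 4 * x) := by
      nlinarith [mul_le_mul_of_nonneg_right h₁ (by linarith : 0 ≤ x + 1),
        mul_nonneg (by linarith : 0 ≤ 1 - x) (by linarith : 0 ≤ 5 - 4 * x)]
    exact le_of_mul_le_mul_right h₂ (by linarith)
  · have h : hiddenReward z m T S ≤ 3 / 4 := by
      simp only [hiddenReward, hzS, if_false, hr]
      linarith
    nlinarith [(isSuccessFunction_hiddenReward (z := z) (m := m) (T := T)).mem_Icc S |>.1]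

theorem mem_revealing_of_isApproxOptimal (hz : z ∉ T) (hm : 0 < m) (hT : T.card = 4 * m)
    {α : ι → ℝ}
    (h : IsApproxOptimal (19 / 20) id (hiddenReward z m T) (hiddenCost z) α S) :
    S ∈ revealing z m T := by
  by_contra hS
  linarith [principalUtility_le_of_notMem_revealing hz h.1 h.2.1 hS,
    four_fifths_le_optimalUtility hz hm hT, h.2.2]

theorem isBinaryInstance_hidden {n : ℕ} {z : Fin n} {T : Finset (Fin n)} (hz : z ∉ T)
    {D : (Fin n → ℝ) → Finset (Fin n)} (hD : IsDemandOracle (hiddenReward z m T) D) :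
    IsBinaryInstance (hiddenCost z) (hiddenReward z m T) D where
  cost_nonneg i := by
    unfold hiddenCost
    by_cases hi : i = z
    · subst hi; rw [Pi.single_eq_same]; norm_num
    · rw [Pi.single_eq_of_ne hi]
  success := isSuccessFunction_hiddenReward
  submodular := isSubmodular_hiddenReward hz
  demand := hD

end HardInstance

/-! ### Concentration for random transversals. -/

section Counting

variable {κ A : Type*}

theorem injective_selection (e : κ × Bool ↪ A) (v : κ → Bool) :
    Function.Injective fun i => e (i, v i) :=
  fun _ _ h => congrArg Prod.fst (e.injective h)

variable [Fintype κ]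

/-- The set that takes the element `e (i, v i)` from each pair `{e (i, true), e (i, false)}`. -/
def transversal (e : κ × Bool ↪ A) (v : κ → Bool) : Finset A :=
  Finset.univ.map ⟨fun i => e (i, v i), injective_selection e v⟩

@[simp] theorem mem_transversal {e : κ × Bool ↪ A} {v : κ → Bool} {x : A} :
    x ∈ transversal e v ↔ ∃ i, e (i, v i) = x := by
  simp only [transversal, Finset.mem_map, Finset.mem_univ, true_and, Function.Embedding.coeFn_mk]

theorem card_transversal (e : κ × Bool ↪ A) (v : κ → Bool) :
    (transversal e v).card = Fintype.card κ := by
  simp [transversal]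

theorem notMem_transversal {e : κ × Bool ↪ A} {z : A} (hz : ∀ x, e x ≠ z) (v : κ → Bool) :
    z ∉ transversal e v := by
  simp [hz]

variable [DecidableEq A]

theorem card_inter_transversal (e : κ × Bool ↪ A) (v : κ → Bool) (S : Finset A) :
    (S ∩ transversal e v).card = ∑ i, if e (i, v i) ∈ S then 1 else 0 := by
  rw [← Finset.card_filter, ← Finset.card_map ⟨fun i => e (i, v i), injective_selection e v⟩]
  congr 1
  ext x
  simp only [mem_transversal, Finset.mem_inter, Finset.mem_map, Finset.mem_filter,
    Finset.mem_univ, true_and, Function.Embedding.coeFn_mk]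
  constructor
  · rintro ⟨hx, i, rfl⟩; exact ⟨i, hx, rfl⟩
  · rintro ⟨i, hx, rfl⟩; exact ⟨hx, i, rfl⟩

/-- Only an inequality, since `S` may contain elements outside all pairs. These only decrease the
exponential moment, as their base is 1/2. -/
theorem sum_le_card_sdiff_transversal (e : κ × Bool ↪ A) (v : κ → Bool) (S : Finset A) :
    (∑ i, if e (i, !v i) ∈ S then 1 else 0) ≤ (S \ transversal e v).card := by
  rw [← card_inter_transversal e (fun i => !v i)]
  refine Finset.card_le_card fun x hx => ?_
  simp only [mem_transversal, Finset.mem_inter, Finset.mem_sdiff, not_exists] at hx ⊢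
  obtain ⟨hx, i, rfl⟩ := hx
  refine ⟨hx, fun j hj => ?_⟩
  have := e.injective hj
  simp only [Prod.mk.injEq] at this
  obtain ⟨rfl, h⟩ := this
  simp at h

variable [DecidableEq κ]

/-- Exponential moment bound for the imbalance of a set between a random transversal and its
complement. -/
theorem sum_exponential_moment_le (e : κ × Bool ↪ A) (S : Finset A) :
    ∑ v : κ → Bool, (2 : ℝ) ^ (S ∩ transversal e v).card *
      (1 / 2) ^ (S \ transversal e v).card ≤ (5 / 2) ^ Fintype.card κ := by
  have hprod : ∀ v : κ → Bool, (2 : ℝ) ^ (S ∩ transversal e v).card *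
      (1 / 2) ^ (S \ transversal e v).card ≤
      ∏ i, (2 : ℝ) ^ (if e (i, v i) ∈ S then 1 else 0) *
        (1 / 2) ^ (if e (i, !v i) ∈ S then 1 else 0) := by
    intro v
    rw [Finset.prod_mul_distrib, Finset.prod_pow_eq_pow_sum, Finset.prod_pow_eq_pow_sum,
      ← card_inter_transversal]
    gcongr ?_ * ?_
    exact pow_le_pow_of_le_one (by norm_num) (by norm_num) (sum_le_card_sdiff_transversal e v S)
  refine (Finset.sum_le_sum fun v _ => hprod v).trans ?_
  rw [← Fintype.piFinset_univ, ← Finset.prod_univ_sum (fun _ : κ => (Finset.univ : Finset Bool))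
    (fun i t => (2 : ℝ) ^ (if e (i, t) ∈ S then 1 else 0) *
        (1 / 2) ^ (if e (i, !t) ∈ S then 1 else 0)), ← Finset.card_univ, ← Finset.prod_const]
  refine Finset.prod_le_prod (fun i _ => by positivity) fun i _ => ?_
  rw [Fintype.sum_bool]
  simp only [Bool.not_true, Bool.not_false]
  -- A pair met by `S` in exactly one element contributes 2 + 1/2; a pair contained in `S` or
  -- disjoint from it contributes 2.
  split_ifs <;> norm_num

-- Markov's inequality: each counted `v` contributes at least 2^(2m) = 4^m to the exponential
-- moment, and (5/2)^4 / 4 = 2^4 · 625/1024.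
open Classical in
theorem card_filter_mem_revealing_le {m : ℕ} (hκ : Fintype.card κ = 4 * m) {e : κ × Bool ↪ A}
    {z : A} (hz : ∀ x, e x ≠ z) (S : Finset A) :
    ((Finset.univ.filter fun v : κ → Bool => S ∈ revealing z m (transversal e v)).card : ℝ) ≤
      (625 / 1024 : ℝ) ^ m * 2 ^ (4 * m) := by
  have h : ((Finset.univ.filter fun v : κ → Bool =>
      S ∈ revealing z m (transversal e v)).card : ℝ) * 4 ^ m ≤ (5 / 2) ^ (4 * m) := by
    rw [← hκ]
    refine le_trans ?_ (sum_exponential_moment_le e S)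
    rw [← nsmul_eq_mul]
    refine (Finset.card_nsmul_le_sum _ _ _ fun v hv => ?_).trans
      (Finset.sum_le_sum_of_subset_of_nonneg (Finset.filter_subset _ _)
        fun v _ _ => by positivity)
    have := card_of_mem_revealing (notMem_transversal hz v) (Finset.mem_filter.1 hv).2
    rw [one_div_pow, mul_one_div, le_div_iff₀ (by positivity),
      show (4 : ℝ) ^ m = 2 ^ (2 * m) by rw [pow_mul]; norm_num, ← pow_add]
    exact pow_le_pow_right₀ (by norm_num) this
  have h4 : (0 : ℝ) < 4 ^ m := by positivity
  refine le_of_mul_le_mul_right (h.trans (le_of_eq ?_)) h4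
  rw [pow_mul, pow_mul]
  have : ((5 / 2 : ℝ) ^ 4) ^ m = (625 / 1024) ^ m * (2 ^ 4) ^ m * 4 ^ m := by
    rw [← mul_pow, ← mul_pow]; norm_num
  exact this

end Counting

/-! ### Averaging over the hidden set. -/

section Averaging

/-- Some event of a finite family has probability at most the average number of events that occur
at the same time. -/
theorem exists_measure_toReal_le_of_card_le {Ω V : Type*} [MeasurableSpace Ω] [Fintype V]
    [Nonempty V] (μ : Measure Ω) [IsProbabilityMeasure μ] {E : V → Set Ω}
    (hE : ∀ v, MeasurableSet (E v)) {M : ℝ}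
    (hM : ∀ ω, ∑ v, (E v).indicator (fun _ => (1 : ℝ)) ω ≤ M) :
    ∃ v, (μ (E v)).toReal ≤ M / Fintype.card V := by
  by_contra! h
  have hint : ∀ v, Integrable ((E v).indicator fun _ => (1 : ℝ)) μ :=
    fun v => (integrable_const 1).indicator (hE v)
  have h₁ : ∑ v, (μ (E v)).toReal ≤ M := by
    calc ∑ v, (μ (E v)).toReal = ∑ v, ∫ ω, (E v).indicator (fun _ => (1 : ℝ)) ω ∂μ := by
          refine Finset.sum_congr rfl fun v _ => ?_
          rw [integral_indicator_const _ (hE v)]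
          simp [Measure.real]
      _ = ∫ ω, ∑ v, (E v).indicator (fun _ => (1 : ℝ)) ω ∂μ :=
          (integral_finsetSum _ fun v _ => hint v).symm
      _ ≤ ∫ _, M ∂μ := integral_mono (integrable_finsetSum _ fun v _ => hint v)
          (integrable_const M) hM
      _ = M := by simp
  have h₂ : ∑ _v : V, M / Fintype.card V < ∑ v, (μ (E v)).toReal :=
    Finset.sum_lt_sum_of_nonempty Finset.univ_nonempty fun v _ => h v
  rw [Finset.sum_const, Finset.card_univ, nsmul_eq_mul,
    mul_div_cancel₀ _ (by positivity)] at h₂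
  linarith

end Averaging

/-! ### The query lower bound and its asymptotic form. -/

theorem RandomizedAlgorithm.exists_successProb_le {n m q : ℕ} (hm : 0 < m) (hn : 8 * m + 1 ≤ n)
    (R : RandomizedAlgorithm n) (hR : R.QueriesAtMost q) :
    ∃ c f D, IsBinaryInstance c f D ∧
      R.successProb (19 / 20) c f D ≤ (q + 1) * (625 / 1024 : ℝ) ^ m := by
  classical
  let z : Fin n := ⟨0, by omega⟩
  -- Pair `i` occupies the positions 2i + 1 and 2i + 2, leaving 0 for `z`; this uses 8m + 1 agents.
  let e : Fin (4 * m) × Bool ↪ Fin n :=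
    ⟨fun x => ⟨2 * x.1 + 1 + x.2.toNat, by
        have := x.1.2; have := Bool.toNat_le x.2; omega⟩, by
      rintro ⟨i, s⟩ ⟨j, t⟩ h
      simp only [Fin.mk.injEq] at h
      have hs := Bool.toNat_le s
      have ht := Bool.toNat_le t
      have h₁ : i = j := Fin.ext (by omega)
      subst h₁
      have h₂ : s = t := by
        cases s <;> cases t <;> simp_all
      rw [h₂]⟩
  have hez : ∀ x, e x ≠ z := by
    intro x h
    have : 2 * x.1.val + 1 + x.2.toNat = 0 := congrArg Fin.val h
    omega
  let T : (Fin (4 * m) → Bool) → Finset (Fin n) := transversal e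
  have hzT : ∀ v, z ∉ T v := notMem_transversal hez
  have hcard : ∀ v, (T v).card = 4 * m := fun v => by
    simp only [T, card_transversal, Fintype.card_fin]
  obtain ⟨D₀, hD₀⟩ := exists_isDemandOracle (hiddenReward z m ∅)
  have hD : ∀ v, ∃ E, IsDemandOracle (hiddenReward z m (T v)) E ∧
      ∀ p, D₀ p ∉ revealing z m (T v) → E p = D₀ p := fun v =>
    hD₀.exists_of_le (hiddenReward_le_hiddenReward_empty (hzT v))
      fun S hS => hiddenReward_eq_of_notMem hS
  choose D hD hDeq using hD
  have inst₀ := isBinaryInstance_hidden (Finset.notMem_empty z) hD₀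
  have inst : ∀ v, IsBinaryInstance (hiddenCost z) (hiddenReward z m (T v)) (D v) :=
    fun v => isBinaryInstance_hidden (hzT v) (hD v)
  let _ := R.mΩ
  have _ := R.isProbabilityMeasure
  let Q : R.Ω → QueryAlgorithm (Fin n) (Fin n) := R.strategy (hiddenCost z)
  let E : (Fin (4 * m) → Bool) → Set R.Ω := fun v =>
    {ω | ((Q ω).run (hiddenReward z m (T v)) (D v)).2 ∈ revealing z m (T v)}
  have hE : ∀ v, MeasurableSet (E v) := by
    intro v
    have : E v = ⋃ S ∈ revealing z m (T v),
        {ω | ((Q ω).run (hiddenReward z m (T v)) (D v)).2 = S} := by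
      ext ω; simp [E]
    rw [this]
    exact MeasurableSet.biUnion (Set.to_countable _)
      fun S _ => R.measurable_actions _ _ _ (inst v) S
  have hcount : ∀ ω, ∑ v, (E v).indicator (fun _ => (1 : ℝ)) ω ≤
      (q + 1) * ((625 / 1024 : ℝ) ^ m * 2 ^ (4 * m)) := by
    intro ω
    -- `W` depends on the seed but not on `v`. The output is included because it may be a witness
    -- that was never queried, hence `q + 1`.
    let W : Finset (Finset (Fin n)) := insert ((Q ω).run (hiddenReward z m ∅) D₀).2
      ((Q ω).disclosed (hiddenReward z m ∅) D₀)
    have hW : W.card ≤ q + 1 := (Finset.card_insert_le _ _).trans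
      (Nat.succ_le_succ ((QueryAlgorithm.card_disclosed_le _ _ _).trans (hR _ _ _ inst₀ ω)))
    have hsub : (Finset.univ.filter fun v => ω ∈ E v) ⊆
        W.biUnion fun S => Finset.univ.filter fun v => S ∈ revealing z m (T v) := by
      intro v hv
      have hv' : ((Q ω).run (hiddenReward z m (T v)) (D v)).2 ∈ revealing z m (T v) :=
        (Finset.mem_filter.1 hv).2
      simp only [Finset.mem_biUnion, Finset.mem_filter, Finset.mem_univ, true_and]
      by_contra! hno
      rw [QueryAlgorithm.run_eq_of_disclosed (B := revealing z m (T v))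
        (fun S hS => hiddenReward_eq_of_notMem hS) (hDeq v) (Q ω)
        fun S hS => hno S (Finset.mem_insert_of_mem hS)] at hv'
      exact hno _ (Finset.mem_insert_self _ _) hv'
    calc ∑ v, (E v).indicator (fun _ => (1 : ℝ)) ω
        = ((Finset.univ.filter fun v => ω ∈ E v).card : ℝ) := by
          simp [Set.indicator_apply, Finset.sum_boole]
      _ ≤ ∑ S ∈ W, ((Finset.univ.filter fun v => S ∈ revealing z m (T v)).card : ℝ) := by
          exact_mod_cast (Finset.card_le_card hsub).trans Finset.card_biUnion_le
      _ ≤ ∑ _S ∈ W, (625 / 1024 : ℝ) ^ m * 2 ^ (4 * m) :=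
          Finset.sum_le_sum fun S _ => card_filter_mem_revealing_le (Fintype.card_fin _) hez S
      _ ≤ (q + 1) * ((625 / 1024 : ℝ) ^ m * 2 ^ (4 * m)) := by
          rw [Finset.sum_const, nsmul_eq_mul]
          gcongr
          exact_mod_cast hW
  obtain ⟨v, hv⟩ := exists_measure_toReal_le_of_card_le R.μ hE hcount
  refine ⟨_, _, _, inst v, ?_⟩
  -- Monotonicity of the measure suffices, so the success event itself need not be measurable.
  have hle : R.successProb (19 / 20) (hiddenCost z) (hiddenReward z m (T v)) (D v) ≤
      (R.μ (E v)).toReal :=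
    ENNReal.toReal_mono (measure_ne_top _ _) (measure_mono fun ω hω =>
      mem_revealing_of_isApproxOptimal (hzT v) hm (hcard v) hω)
  refine hle.trans (hv.trans (le_of_eq ?_))
  rw [Fintype.card_fun, Fintype.card_bool, Fintype.card_fin]
  push_cast
  field_simp

/-- Since 625/1024 = (25/32)², it suffices that e ≤ (32/25)^5. -/
theorem pow_le_exp_neg (m : ℕ) : (625 / 1024 : ℝ) ^ m ≤ Real.exp (-(2 / 5) * m) := by
  have h5 : Real.exp (1 / 5) ^ 5 ≤ (32 / 25 : ℝ) ^ 5 := by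
    rw [← Real.exp_nat_mul]
    norm_num
    linarith [Real.exp_one_lt_d9]
  have h : Real.exp (1 / 5) ≤ 32 / 25 := le_of_pow_le_pow_left₀ (by norm_num) (by norm_num) h5
  have h' : (25 / 32 : ℝ) ≤ Real.exp (-(1 / 5)) := by
    rw [Real.exp_neg, le_inv_comm₀ (by norm_num) (Real.exp_pos _)]
    exact h.trans (by norm_num)
  rw [mul_comm, Real.exp_nat_mul]
  refine pow_le_pow_left₀ (by norm_num) ?_ m
  rw [show (-(2 / 5) : ℝ) = -(1 / 5) + -(1 / 5) by norm_num, Real.exp_add]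
  nlinarith

theorem eventually_exists_successProb_le {q : ℕ → ℕ} (hq : IsSubexponential q) :
    ∀ᶠ n : ℕ in atTop, ∀ R : RandomizedAlgorithm n, R.QueriesAtMost (q n) →
      ∃ c f D, IsBinaryInstance c f D ∧
        R.successProb (19 / 20) c f D ≤ Real.exp (-(1 / 50) * n) := by
  filter_upwards [hq (1 / 100) (by norm_num), eventually_ge_atTop 200] with n hqn hn R hR
  obtain ⟨c, f, D, hinst, h⟩ :=
    R.exists_successProb_le (m := (n - 1) / 8) (by omega) (by omega) hR
  refine ⟨c, f, D, hinst, h.trans ?_⟩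
  have hn' : (200 : ℝ) ≤ n := by exact_mod_cast hn
  have hm : (n : ℝ) / 8 - 1 ≤ ((n - 1) / 8 : ℕ) := by
    have : n ≤ 8 * ((n - 1) / 8) + 8 := by omega
    have : (n : ℝ) ≤ 8 * ((n - 1) / 8 : ℕ) + 8 := by exact_mod_cast this
    linarith
  have h2 : (2 : ℝ) ≤ Real.exp 1 := by linarith [Real.add_one_le_exp (1 : ℝ)]
  have hq' : (q n : ℝ) + 1 ≤ Real.exp 1 * Real.exp (1 / 100 * n) := by
    have : 1 ≤ Real.exp (1 / 100 * (n : ℝ)) := Real.one_le_exp (by positivity)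
    nlinarith
  calc ((q n : ℝ) + 1) * (625 / 1024 : ℝ) ^ ((n - 1) / 8)
      ≤ (Real.exp 1 * Real.exp (1 / 100 * n)) *
        Real.exp (-(2 / 5) * ((n - 1) / 8 : ℕ)) := by
        gcongr
        exact pow_le_exp_neg _
    _ = Real.exp (1 + 1 / 100 * n + -(2 / 5) * ((n - 1) / 8 : ℕ)) := by
        simp only [Real.exp_add]
    -- With m ≥ n/8 - 1 the exponent is at most 7/5 - n/25, and 7/5 ≤ n/50 for n ≥ 200.
    _ ≤ Real.exp (-(1 / 50) * n) := Real.exp_le_exp.2 (by linarith)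

theorem isSubexponential_polynomial_eval (P : Polynomial ℕ) :
    IsSubexponential fun n => P.eval n := by
  intro ε hε
  -- The rescaled polynomial P(y/ε) is dominated by exp(y), evaluated along y = εn.
  have h := (((P.map (Nat.castRingHom ℝ)).comp
    (Polynomial.C ε⁻¹ * Polynomial.X)).tendsto_div_exp_atTop).comp
    (tendsto_natCast_atTop_atTop.const_mul_atTop hε)
  filter_upwards [h.eventually (eventually_le_nhds (zero_lt_one))] with n hn
  simp only [Function.comp_apply, Polynomial.eval_comp, Polynomial.eval_mul, Polynomial.eval_C,
    Polynomial.eval_X, inv_mul_cancel_left₀ hε.ne', Polynomial.eval_natCast_map] at hn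
  rw [div_le_one (Real.exp_pos _)] at hn
  simpa using hn

theorem not_hasPolyQueryPTAS {δ : ℝ} (hδ : 0 < δ) : ¬ HasPolyQueryPTAS δ := by
  intro h
  obtain ⟨P, R, hR⟩ := h (1 / 20) (by norm_num)
  have hlim : Tendsto (fun n : ℕ => Real.exp (-(1 / 50) * n)) atTop (nhds 0) :=
    Real.tendsto_exp_atBot.comp
      (tendsto_natCast_atTop_atTop.const_mul_atTop_of_neg (by norm_num))
  obtain ⟨n, hn, hlt⟩ := ((eventually_exists_successProb_le
    (isSubexponential_polynomial_eval P)).and (hlim.eventually (eventually_lt_nhds hδ))).exists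
  obtain ⟨c, f, D, hinst, hle⟩ := hn (R n) (hR n).1
  have := (hR n).2 c f D hinst
  rw [show (1 - 1 / 20 : ℝ) = 19 / 20 by norm_num] at this
  linarith

end Contracts

theorem theorem2 :
    (∃ η : ℝ, 0 < η ∧ η < 1 ∧ ∃ b : ℝ, 0 < b ∧
      ∀ q : ℕ → ℕ, Contracts.IsSubexponential q →
        ∀ᶠ n : ℕ in Filter.atTop,
          ∀ R : Contracts.RandomizedAlgorithm n, R.QueriesAtMost (q n) →
            ∃ c f D, Contracts.IsBinaryInstance c f D ∧
              R.successProb η c f D ≤ Real.exp (-b * n)) ∧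
    (∀ δ : ℝ, 0 < δ → ¬ Contracts.HasPolyQueryPTAS δ) :=
  ⟨⟨19 / 20, by norm_num, by norm_num, 1 / 50, by norm_num,
    fun _ hq => Contracts.eventually_exists_successProb_le hq⟩,
    fun _ hδ => Contracts.not_hasPolyQueryPTAS hδ⟩
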